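/- Let $F_2$ be the free group on $x,y$, let $r\ge 1$, and let $w=x^{a_1}y^{b_1}\cdots x^{a_r}y^{b_r}\in F_2$, where all the integers $a_1,\dots,a_r,b_1,\dots,b_r$ are nonzero. Let $f_w\in\mathbb{Z}[s,u,t]$ be the trace polynomial of $w$, that is, the unique polynomial such that $$\operatorname{tr} w(g_1,g_2)=f_w\bigl(\operatorname{tr} g_1,\ \operatorname{tr}(g_1g_2),\ \operatorname{tr} g_2\bigr)$$ for every commutative ring $k$ with $1$ and all $g_1,g_2\in \mathrm{SL}_2(k)$. Let $D_r$ be the $r$-th Dickson polynomial (of the first kind, with parameter $1$), determined by $D_r(z+z^{-1})=z^r+z^{-r}$. If there is a polynomial $q\in\mathbb{Q}[s,u,t]$ such that $f_w(s,u,t)=D_r(q(s,u,t))$ in $\mathbb{Q}[s,u,t]$, then $w=(x^{a_1}y^{b_1})^r$. -/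

import Mathlib

open scoped MatrixGroups

/-- The word `x^{a₁} y^{b₁} ⋯ x^{a_r} y^{b_r}` in the free group on two generators
`x = FreeGroup.of 0`, `y = FreeGroup.of 1`. -/
def syllableWord {r : ℕ} (a b : Fin r → ℤ) : FreeGroup (Fin 2) :=
  (List.ofFn fun i : Fin r =>
    (FreeGroup.of 0 : FreeGroup (Fin 2)) ^ a i * FreeGroup.of 1 ^ b i).prod

/-- The value `w(g₁, g₂)` of a word `w` in two letters at a pair of group elements. -/
def wordValue {G : Type*} [Group G] (w : FreeGroup (Fin 2)) (g₁ g₂ : G) : G :=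
  FreeGroup.lift ![g₁, g₂] w

/-- `f ∈ ℤ[s, u, t]` (the variables `0, 1, 2` are `s, u, t`) is a trace polynomial of `w` if
`tr w(g₁, g₂) = f(tr g₁, tr (g₁ g₂), tr g₂)` for all `g₁, g₂ ∈ SL₂(k)` and every commutative
ring `k`. -/
def IsTracePolynomial (w : FreeGroup (Fin 2)) (f : MvPolynomial (Fin 3) ℤ) : Prop :=
  ∀ (k : Type) [CommRing k] (g₁ g₂ : SL(2, k)),
    ((wordValue w g₁ g₂ : SL(2, k)) : Matrix (Fin 2) (Fin 2) k).trace =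
      MvPolynomial.aeval ![(g₁ : Matrix (Fin 2) (Fin 2) k).trace,
        ((g₁ * g₂ : SL(2, k)) : Matrix (Fin 2) (Fin 2) k).trace,
        (g₂ : Matrix (Fin 2) (Fin 2) k).trace] f

/-- Auxiliary to existence: `w(g₁, g₂)` is a combination of `1, g₁, g₂, g₁ g₂` whose coefficients
are universal integer polynomials in the three traces. -/
def HasTraceExpansion (w : FreeGroup (Fin 2)) : Prop :=
  ∃ c₀ c₁ c₂ c₃ : MvPolynomial (Fin 3) ℤ, ∀ (k : Type) [CommRing k] (g₁ g₂ : SL(2, k)),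
    let X : Matrix (Fin 2) (Fin 2) k := g₁
    let Y : Matrix (Fin 2) (Fin 2) k := g₂
    let ev := MvPolynomial.aeval (R := ℤ) ![X.trace, (X * Y).trace, Y.trace]
    ((wordValue w g₁ g₂ : SL(2, k)) : Matrix (Fin 2) (Fin 2) k) =
      ev c₀ • (1 : Matrix (Fin 2) (Fin 2) k) + ev c₁ • X + ev c₂ • Y + ev c₃ • (X * Y)

theorem HasTraceExpansion.gen_mul (i : Fin 2) {v : FreeGroup (Fin 2)}
    (hv : HasTraceExpansion v) : HasTraceExpansion (FreeGroup.of i * v) := by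
  obtain ⟨c₀, c₁, c₂, c₃, h⟩ := hv
  let s : MvPolynomial (Fin 3) ℤ := MvPolynomial.X 0
  let u : MvPolynomial (Fin 3) ℤ := MvPolynomial.X 1
  let t : MvPolynomial (Fin 3) ℤ := MvPolynomial.X 2
  fin_cases i
  · refine ⟨-c₁, c₀ + s * c₁, -c₃, c₂ + s * c₃, ?_⟩
    intro k _ g₁ g₂ X Y ev
    have hX : X * X = X.trace • X - 1 := by
      have hd : X.det = 1 := g₁.2
      rw [Matrix.det_fin_two] at hd
      ext i j
      fin_cases i <;> fin_cases j <;>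
        simp [Matrix.mul_apply, Fin.sum_univ_two, Matrix.trace_fin_two] <;>
        first | linear_combination -hd | ring
    have hw : ((wordValue (FreeGroup.of 0 * v) g₁ g₂ : SL(2, k)) : Matrix (Fin 2) (Fin 2) k)
        = X * ((wordValue v g₁ g₂ : SL(2, k)) : Matrix (Fin 2) (Fin 2) k) := by
      simp [wordValue, X]
    have hs : ev s = X.trace := by simp [ev, s]
    have h' := h k g₁ g₂
    dsimp only at h'
    refine hw.trans ?_
    rw [h']
    change X * (ev c₀ • 1 + ev c₁ • X + ev c₂ • Y + ev c₃ • (X * Y)) = _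
    simp only [map_neg, map_add, map_mul, hs, mul_add, Matrix.mul_smul, ← mul_assoc, hX, mul_one,
      sub_mul, one_mul, Matrix.smul_mul]
    module
  · refine ⟨(u - s * t) * c₁ - c₂ - s * c₃, t * c₁ + c₃, c₀ + s * c₁ + t * c₂ + u * c₃, -c₁, ?_⟩
    intro k _ g₁ g₂ X Y ev
    have hd : X.det = 1 := g₁.2
    have hd' : Y.det = 1 := g₂.2
    rw [Matrix.det_fin_two] at hd hd'
    have hY : Y * Y = Y.trace • Y - 1 := by
      ext i j
      fin_cases i <;> fin_cases j <;>
        simp [Matrix.mul_apply, Fin.sum_univ_two, Matrix.trace_fin_two] <;>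
        first | linear_combination -hd' | ring
    have hYX : Y * X = ((X * Y).trace - X.trace * Y.trace) • (1 : Matrix (Fin 2) (Fin 2) k)
        + Y.trace • X + X.trace • Y - X * Y := by
      ext i j
      fin_cases i <;> fin_cases j <;>
        simp [Matrix.mul_apply, Fin.sum_univ_two, Matrix.trace_fin_two] <;> ring
    have hYXY : Y * (X * Y) = (X * Y).trace • Y - X.trace • (1 : Matrix (Fin 2) (Fin 2) k)
        + X := by
      rw [← mul_assoc, hYX]
      simp only [sub_mul, add_mul, Matrix.smul_mul, one_mul, mul_assoc, hY, mul_sub,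
        Matrix.mul_smul, mul_one]
      module
    have hw : ((wordValue (FreeGroup.of 1 * v) g₁ g₂ : SL(2, k)) : Matrix (Fin 2) (Fin 2) k)
        = Y * ((wordValue v g₁ g₂ : SL(2, k)) : Matrix (Fin 2) (Fin 2) k) := by
      simp [wordValue, Y]
    have hs : ev s = X.trace := by simp [ev, s]
    have hu : ev u = (X * Y).trace := by simp [ev, u]
    have ht : ev t = Y.trace := by simp [ev, t]
    have h' := h k g₁ g₂
    dsimp only at h'
    refine hw.trans ?_
    rw [h']
    change Y * (ev c₀ • 1 + ev c₁ • X + ev c₂ • Y + ev c₃ • (X * Y)) = _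
    simp only [map_neg, map_add, map_sub, map_mul, hs, hu, ht, mul_add, Matrix.mul_smul, hY, hYX,
      hYXY, mul_one]
    module

theorem HasTraceExpansion.gen_inv_mul (i : Fin 2) {v : FreeGroup (Fin 2)}
    (hv : HasTraceExpansion v) : HasTraceExpansion ((FreeGroup.of i)⁻¹ * v) := by
  obtain ⟨d₀, d₁, d₂, d₃, h₂⟩ := hv.gen_mul i
  obtain ⟨c₀, c₁, c₂, c₃, h₁⟩ := hv
  let z : MvPolynomial (Fin 3) ℤ := MvPolynomial.X (![0, 2] i)
  refine ⟨z * c₀ - d₀, z * c₁ - d₁, z * c₂ - d₂, z * c₃ - d₃, ?_⟩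
  intro k _ g₁ g₂ X Y ev
  let Z : SL(2, k) := ![g₁, g₂] i
  have hz : ev z = (Z : Matrix (Fin 2) (Fin 2) k).trace := by
    fin_cases i <;> simp [ev, z, Z, X, Y]
  have hZ : ((Z⁻¹ : SL(2, k)) : Matrix (Fin 2) (Fin 2) k) =
      (Z : Matrix (Fin 2) (Fin 2) k).trace • (1 : Matrix (Fin 2) (Fin 2) k) - Z := by
    rw [Matrix.SpecialLinearGroup.coe_inv, Matrix.adjugate_fin_two]
    ext i j
    fin_cases i <;> fin_cases j <;> simp [Matrix.trace_fin_two]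
  have hw : ((wordValue ((FreeGroup.of i)⁻¹ * v) g₁ g₂ : SL(2, k)) : Matrix (Fin 2) (Fin 2) k) =
      (Z : Matrix (Fin 2) (Fin 2) k).trace • ((wordValue v g₁ g₂ : SL(2, k)) : Matrix (Fin 2) (Fin 2) k)
        - ((wordValue (FreeGroup.of i * v) g₁ g₂ : SL(2, k)) : Matrix (Fin 2) (Fin 2) k) := by
    have e₁ : wordValue ((FreeGroup.of i)⁻¹ * v) g₁ g₂ = Z⁻¹ * wordValue v g₁ g₂ := by
      simp [wordValue, Z]
    have e₂ : wordValue (FreeGroup.of i * v) g₁ g₂ = Z * wordValue v g₁ g₂ := by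
      simp [wordValue, Z]
    rw [e₁, e₂, Matrix.SpecialLinearGroup.coe_mul, Matrix.SpecialLinearGroup.coe_mul, hZ,
      sub_mul, Matrix.smul_mul, one_mul]
  have h₁' := h₁ k g₁ g₂
  have h₂' := h₂ k g₁ g₂
  dsimp only at h₁' h₂'
  refine hw.trans ?_
  rw [h₁', h₂', ← hz]
  change ev z • (ev c₀ • 1 + ev c₁ • X + ev c₂ • Y + ev c₃ • (X * Y))
    - (ev d₀ • 1 + ev d₁ • X + ev d₂ • Y + ev d₃ • (X * Y)) = _
  simp only [map_sub, map_mul]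
  module

theorem hasTraceExpansion (w : FreeGroup (Fin 2)) : HasTraceExpansion w := by
  have h1 : HasTraceExpansion 1 := ⟨1, 0, 0, 0, fun k _ g₁ g₂ => by simp [wordValue]⟩
  have key : ∀ v, HasTraceExpansion v → HasTraceExpansion (w * v) := by
    induction w using FreeGroup.induction_on with
    | C1 => intro v hv; simpa using hv
    | of i => intro v hv; exact hv.gen_mul i
    | inv_of i _ => intro v hv; exact hv.gen_inv_mul i
    | mul x y hx hy => intro v hv; rw [mul_assoc]; exact hx _ (hy v hv)
  simpa using key 1 h1

theorem exists_isTracePolynomial (w : FreeGroup (Fin 2)) : ∃ f, IsTracePolynomial w f := by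
  obtain ⟨c₀, c₁, c₂, c₃, h⟩ := hasTraceExpansion w
  refine ⟨2 * c₀ + MvPolynomial.X 0 * c₁ + MvPolynomial.X 2 * c₂ + MvPolynomial.X 1 * c₃, ?_⟩
  intro k _ g₁ g₂
  have h' := h k g₁ g₂
  dsimp only at h'
  rw [h']
  simp only [Matrix.trace_add, Matrix.trace_smul, Matrix.trace_one, map_add, map_mul,
    MvPolynomial.aeval_X, smul_eq_mul, Matrix.SpecialLinearGroup.coe_mul, map_ofNat,
    Fintype.card_fin]
  simp
  ring

theorem IsTracePolynomial.unique {w : FreeGroup (Fin 2)} {f g : MvPolynomial (Fin 3) ℤ}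
    (hf : IsTracePolynomial w f) (hg : IsTracePolynomial w g) : f = g := by
  apply MvPolynomial.map_injective (Int.castRingHom ℂ) Int.cast_injective
  apply MvPolynomial.funext
  intro p
  obtain ⟨z, hz⟩ := IsAlgClosed.exists_pow_nat_eq ((p 1) ^ 2 / 4 - 1) (n := 2) two_pos
  let g₁ : SL(2, ℂ) := ⟨!![p 0, -1; 1, 0], by simp [Matrix.det_fin_two]⟩
  let g₂ : SL(2, ℂ) := ⟨!![0, p 1 / 2 + z; z - p 1 / 2, p 2], by
    rw [Matrix.det_fin_two_of]; linear_combination -hz⟩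
  have hp : ![(g₁ : Matrix (Fin 2) (Fin 2) ℂ).trace,
        ((g₁ * g₂ : SL(2, ℂ)) : Matrix (Fin 2) (Fin 2) ℂ).trace,
        (g₂ : Matrix (Fin 2) (Fin 2) ℂ).trace] = p := by
    ext i
    fin_cases i
    · simp [g₁, Matrix.trace_fin_two]
    · change (((g₁ * g₂ : SL(2, ℂ)) : Matrix (Fin 2) (Fin 2) ℂ)).trace = p 1
      rw [Matrix.SpecialLinearGroup.coe_mul, Matrix.trace_fin_two]
      simp [g₁, g₂, Matrix.mul_apply, Fin.sum_univ_two]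
    · simp [g₂, Matrix.trace_fin_two]
  have := (hf ℂ g₁ g₂).symm.trans (hg ℂ g₁ g₂)
  rw [hp] at this
  simpa [MvPolynomial.eval_map, MvPolynomial.aeval_def] using this

/-- The trace polynomial `f_w ∈ ℤ[s, u, t]` of `w`: the unique polynomial with
`tr w(g₁, g₂) = f_w(tr g₁, tr (g₁ g₂), tr g₂)` on `SL₂`. -/
noncomputable def tracePolynomial (w : FreeGroup (Fin 2)) : MvPolynomial (Fin 3) ℤ :=
  (exists_isTracePolynomial w).choose

theorem tracePolynomial_spec (w : FreeGroup (Fin 2)) : IsTracePolynomial w (tracePolynomial w) :=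
  (exists_isTracePolynomial w).choose_spec

/-! Put matrices over `R[X]`, with `R` a domain over ℚ, into `w`. The trace becomes `D_r(Q)` for
some `Q` in `R[X]`. As `D_r` is monic of degree `r`, a nonzero coefficient in degree `r * N` that
bounds the degree, with `N > 0`, must be an `r`-th power (`exists_pow_eq_trace_prod`). Two choices
of matrices then suffice.

Sizes: for one matrix of constant trace `2x` and one unipotent matrix with the variable in its
corner, the top coefficient is `∏ b_i U_{a_i-1}(x)`. If `n ≥ 2` is the largest `|a_i|`, the
multiplicity of the root `cos(π/n)` is the number of `i` with `|a_i| = n`. It is positive, at most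
`r` and divisible by `r`, so all `|a_i|` agree. Exchanging the two matrices treats the `b_i`.

Signs: take two companion matrices of trace `X`, one conjugated by a fixed `P`. The leading matrix
of a nonzero power is a rank-one idempotent determined by the sign of the exponent, and the top
coefficient is `±2^K`, where `K` counts certain sign coincidences between neighbouring exponents.
Then `r ∣ K` and `K ≤ r` leave `K = 0` or `K = r`, and each makes the signs constant around the
cyclic word. -/

/-! ### Top coefficients of polynomial matrices -/

section TopCoefficient

open Polynomial

/-- The entries of `M` have degree at most `N`, and `E` is the matrix of their coefficients of
degree `N`. -/
def HasTopCoeff {R : Type*} [CommRing R] (M : Matrix (Fin 2) (Fin 2) R[X]) (N : ℕ)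
    (E : Matrix (Fin 2) (Fin 2) R) : Prop :=
  (matPolyEquiv M).natDegree ≤ N ∧ (matPolyEquiv M).coeff N = E

variable {R : Type*} [CommRing R] {M M' : Matrix (Fin 2) (Fin 2) R[X]} {N N' : ℕ}
  {E E' : Matrix (Fin 2) (Fin 2) R}

theorem hasTopCoeff_of_entries (h : ∀ i j, (M i j).natDegree ≤ N ∧ (M i j).coeff N = E i j) :
    HasTopCoeff M N E := by
  constructor
  · rw [natDegree_le_iff_coeff_eq_zero]
    intro m hm
    ext i j
    rw [matPolyEquiv_coeff_apply]
    exact coeff_eq_zero_of_natDegree_lt ((h i j).1.trans_lt hm)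
  · ext i j
    rw [matPolyEquiv_coeff_apply]
    exact (h i j).2

theorem hasTopCoeff_map_C (E : Matrix (Fin 2) (Fin 2) R) : HasTopCoeff (E.map C) 0 E := by
  simp [HasTopCoeff]

/-- `matPolyEquiv` is a ring isomorphism onto polynomials with matrix coefficients. Only degree
bounds are claimed, so `E * E'` may vanish. -/
theorem HasTopCoeff.mul (h : HasTopCoeff M N E) (h' : HasTopCoeff M' N' E') :
    HasTopCoeff (M * M') (N + N') (E * E') := by
  unfold HasTopCoeff
  rw [map_mul, coeff_mul_add_eq_of_natDegree_le h.1 h'.1, h.2, h'.2]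
  exact ⟨natDegree_mul_le_of_le h.1 h'.1, rfl⟩

theorem HasTopCoeff.list_prod_ofFn {r : ℕ} {M : Fin r → Matrix (Fin 2) (Fin 2) R[X]}
    {E : Fin r → Matrix (Fin 2) (Fin 2) R} (h : ∀ i, HasTopCoeff (M i) N (E i)) :
    HasTopCoeff (List.ofFn M).prod (r * N) (List.ofFn E).prod := by
  induction r with
  | zero => simpa using hasTopCoeff_map_C (1 : Matrix (Fin 2) (Fin 2) R)
  | succ r ih =>
    rw [List.ofFn_succ, List.ofFn_succ, List.prod_cons, List.prod_cons,
      show (r + 1) * N = N + r * N by ring]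
    exact (h 0).mul (ih fun i => h i.succ)

theorem HasTopCoeff.trace (h : HasTopCoeff M N E) :
    M.trace.natDegree ≤ N ∧ M.trace.coeff N = E.trace := by
  have hd (i : Fin 2) : (M i i).natDegree ≤ N := by
    rw [natDegree_le_iff_coeff_eq_zero]
    intro m hm
    rw [← matPolyEquiv_coeff_apply, coeff_eq_zero_of_natDegree_lt (h.1.trans_lt hm)]
    rfl
  rw [Matrix.trace_fin_two, Matrix.trace_fin_two, coeff_add, ← matPolyEquiv_coeff_apply,
    ← matPolyEquiv_coeff_apply, h.2]
  exact ⟨natDegree_add_le_of_degree_le (hd 0) (hd 1), rfl⟩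

end TopCoefficient

/-! ### Leading terms of Chebyshev and Dickson polynomials -/

section Chebyshev

open Polynomial

theorem monic_natDegree_chebyshev_S {R : Type*} [CommRing R] [Nontrivial R] (n : ℕ) :
    (Chebyshev.S R n).Monic ∧ (Chebyshev.S R n).natDegree = n := by
  induction n using Nat.twoStepInduction with
  | zero => simp
  | one => simp [monic_X]
  | more n h0 h1 =>
    have hm : (X * Chebyshev.S R ((n + 1 : ℕ) : ℤ)).Monic := monic_X.mul h1.1
    have hd : (X * Chebyshev.S R ((n + 1 : ℕ) : ℤ)).natDegree = n + 2 := by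
      rw [monic_X.natDegree_mul h1.1, h1.2, natDegree_X]; ring
    have hlt : (Chebyshev.S R (n : ℤ)).degree < (X * Chebyshev.S R ((n + 1 : ℕ) : ℤ)).degree := by
      apply degree_lt_degree
      rw [hd, h0.2]
      omega
    have he : Chebyshev.S R ((n + 2 : ℕ) : ℤ)
        = X * Chebyshev.S R ((n + 1 : ℕ) : ℤ) - Chebyshev.S R (n : ℤ) := by
      push_cast
      exact Chebyshev.S_add_two R n
    rw [he]
    exact ⟨hm.sub_of_left hlt, by rw [natDegree_sub_eq_left_of_natDegree_lt (by omega), hd]⟩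

theorem monic_natDegree_dickson_one_one {R : Type*} [CommRing R] [Nontrivial R] (n : ℕ) :
    (dickson 1 (1 : R) (n + 1)).Monic ∧ (dickson 1 (1 : R) (n + 1)).natDegree = n + 1 := by
  have key (n : ℕ) : dickson 1 (1 : R) (n + 1)
      = X * Chebyshev.S R n - 2 * Chebyshev.S R (n - 1) := by
    rw [dickson_one_one_eq_chebyshev_C, Chebyshev.C_eq_S_sub_X_mul_S, Nat.cast_succ,
      add_sub_cancel_right, Chebyshev.S_add_one]
    ring
  have hS := monic_natDegree_chebyshev_S (R := R) n
  have hm : (X * Chebyshev.S R (n : ℤ)).Monic := monic_X.mul hS.1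
  have hd : (X * Chebyshev.S R (n : ℤ)).natDegree = n + 1 := by
    rw [monic_X.natDegree_mul hS.1, hS.2, natDegree_X]; ring
  have hle : (2 * Chebyshev.S R (n - 1)).natDegree < n + 1 := by
    -- For `n = 0` the subtracted term vanishes, because `S_{-1} = 0`.
    rcases n with _ | n
    · simp
    · have := monic_natDegree_chebyshev_S (R := R) n
      rw [Nat.cast_succ, add_sub_cancel_right]
      refine (natDegree_mul_le (p := 2)).trans_lt ?_
      rw [this.2, natDegree_ofNat]
      omega
  rw [key]
  refine ⟨hm.sub_of_left (degree_lt_degree (by rwa [hd])), ?_⟩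
  rw [natDegree_sub_eq_left_of_natDegree_lt (by rwa [hd]), hd]

/-- If `D_r(Q)` has degree at most `N r` and its coefficient in degree `N r` does not vanish, then
this coefficient is an `r`-th power. -/
theorem exists_pow_eq_coeff_dickson {R : Type*} [CommRing R] [IsDomain R] {r N : ℕ} (hr : 0 < r)
    (hN0 : 0 < N) (Q : R[X]) (hN : ((dickson 1 (1 : R[X]) r).eval Q).natDegree ≤ r * N)
    (h0 : ((dickson 1 (1 : R[X]) r).eval Q).coeff (r * N) ≠ 0) :
    ∃ c, ((dickson 1 (1 : R[X]) r).eval Q).coeff (r * N) = c ^ r := by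
  obtain ⟨r, rfl⟩ : ∃ k, r = k + 1 := ⟨r - 1, by omega⟩
  have he : (dickson 1 (1 : R[X]) (r + 1)).eval Q = (dickson 1 (1 : R) (r + 1)).comp Q := by
    rw [← C_1, ← map_dickson C, eval_map]; rfl
  obtain ⟨hm, hd⟩ := monic_natDegree_dickson_one_one (R := R) r
  rw [he] at hN h0 ⊢
  have hdeg := hN.antisymm (le_natDegree_of_ne_zero h0)
  rw [natDegree_comp, hd] at hdeg
  have hQ : Q.natDegree = N := Nat.eq_of_mul_eq_mul_left hr hdeg
  refine ⟨Q.leadingCoeff, ?_⟩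
  -- Here `N > 0` is needed: for constant `Q` the lower terms of `D_r` would also contribute.
  have := coeff_comp_degree_mul_degree (p := dickson 1 (1 : R) (r + 1)) (q := Q) (by omega)
  rwa [hm.leadingCoeff, hd, hQ, one_mul] at this

end Chebyshev

/-! ### Powers of the test matrices and the power criterion -/

section Matrices

open Polynomial

/-- The matrix of trace `s` and determinant `1` in companion form. -/
def companionSL {k : Type*} [CommRing k] (s : k) : SL(2, k) :=
  ⟨!![s, -1; 1, 0], by simp [Matrix.det_fin_two]⟩

/-- Multiplication by the matrix or its inverse is the recurrence of `S`. The extension of `S` to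
negative indices gives one formula for both signs. -/
theorem coe_companionSL_zpow {k : Type*} [CommRing k] (s : k) (n : ℤ) :
    ((companionSL s ^ n : SL(2, k)) : Matrix (Fin 2) (Fin 2) k) =
      !![(Chebyshev.S k n).eval s, -(Chebyshev.S k (n - 1)).eval s;
        (Chebyshev.S k (n - 1)).eval s, -(Chebyshev.S k (n - 2)).eval s] := by
  have h1 : ((companionSL s : SL(2, k)) : Matrix (Fin 2) (Fin 2) k) = !![s, -1; 1, 0] := rfl
  have h2 : (((companionSL s)⁻¹ : SL(2, k)) : Matrix (Fin 2) (Fin 2) k) = !![0, 1; -1, s] := by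
    rw [Matrix.SpecialLinearGroup.coe_inv, h1, Matrix.adjugate_fin_two]
    simp
  induction n using Int.induction_on with
  | zero =>
    ext i j
    fin_cases i <;> fin_cases j <;> simp
  | succ n ih =>
    rw [zpow_add_one, Matrix.SpecialLinearGroup.coe_mul, ih, h1]
    have e1 := congrArg (eval s) (Chebyshev.S_add_one k n)
    have e2 := congrArg (eval s) (Chebyshev.S_sub_two k n)
    simp only [eval_sub, eval_mul, eval_X] at e1 e2
    rw [show (n : ℤ) + 1 - 1 = n by ring, show (n : ℤ) + 1 - 2 = n - 1 by ring]
    ext i j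
    fin_cases i <;> fin_cases j <;> simp [Matrix.mul_apply, Fin.sum_univ_two]
    · linear_combination -e1
    · linear_combination -e2
  | pred n ih =>
    rw [zpow_sub_one, Matrix.SpecialLinearGroup.coe_mul, ih, h2]
    have e1 := congrArg (eval s) (Chebyshev.S_sub_two k (-n))
    have e2 := congrArg (eval s) (Chebyshev.S_sub_two k (-n - 1))
    simp only [eval_sub, eval_mul, eval_X] at e1 e2
    rw [show -(n : ℤ) - 1 - 1 = -n - 2 by ring] at e2 ⊢
    ext i j
    fin_cases i <;> fin_cases j <;> simp [Matrix.mul_apply, Fin.sum_univ_two,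
      -Chebyshev.S_neg_sub_two]
    · linear_combination e1
    · linear_combination e2

/-- The upper unipotent matrix with corner entry `t`. -/
def unipotentSL {k : Type*} [CommRing k] (t : k) : SL(2, k) :=
  ⟨!![1, t; 0, 1], by simp [Matrix.det_fin_two]⟩

theorem coe_unipotentSL_zpow {k : Type*} [CommRing k] (t : k) (n : ℤ) :
    ((unipotentSL t ^ n : SL(2, k)) : Matrix (Fin 2) (Fin 2) k) = !![1, n * t; 0, 1] := by
  have h1 : ((unipotentSL t : SL(2, k)) : Matrix (Fin 2) (Fin 2) k) = !![1, t; 0, 1] := rfl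
  have h2 : (((unipotentSL t)⁻¹ : SL(2, k)) : Matrix (Fin 2) (Fin 2) k) = !![1, -t; 0, 1] := by
    rw [Matrix.SpecialLinearGroup.coe_inv, h1, Matrix.adjugate_fin_two]
    simp
  induction n using Int.induction_on with
  | zero => simp [Matrix.one_fin_two]
  | succ n ih =>
    rw [zpow_add_one, Matrix.SpecialLinearGroup.coe_mul, ih, h1, Matrix.mul_fin_two]
    ext i j
    fin_cases i <;> fin_cases j <;> simp
    ring
  | pred n ih =>
    rw [zpow_sub_one, Matrix.SpecialLinearGroup.coe_mul, ih, h2, Matrix.mul_fin_two]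
    ext i j
    fin_cases i <;> fin_cases j <;> simp
    ring

theorem wordValue_syllableWord {G : Type*} [Group G] {r : ℕ} (a b : Fin r → ℤ) (g₁ g₂ : G) :
    wordValue (syllableWord a b) g₁ g₂ = (List.ofFn fun i => g₁ ^ a i * g₂ ^ b i).prod := by
  simp [wordValue, syllableWord, map_list_prod, List.map_ofFn, Function.comp_def]

theorem coe_wordValue_syllableWord {k : Type*} [CommRing k] {r : ℕ} (a b : Fin r → ℤ)
    (g₁ g₂ : SL(2, k)) :
    ((wordValue (syllableWord a b) g₁ g₂ : SL(2, k)) : Matrix (Fin 2) (Fin 2) k) =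
      (List.ofFn fun i => ((g₁ ^ a i : SL(2, k)) : Matrix (Fin 2) (Fin 2) k) *
        ((g₂ ^ b i : SL(2, k)) : Matrix (Fin 2) (Fin 2) k)).prod := by
  rw [wordValue_syllableWord]
  simp [← Matrix.SpecialLinearGroup.coeMonoidHom_apply, map_list_prod, List.map_ofFn,
    Function.comp_def]

/-- If the trace polynomial of `w` is `D_r(q)` over `ℚ`, then `tr w(g₁, g₂)` is a value of `D_r` for
all `g₁, g₂` over a `ℚ`-algebra. -/
theorem exists_trace_wordValue_eq_dickson {w : FreeGroup (Fin 2)} {r : ℕ}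
    {q : MvPolynomial (Fin 3) ℚ}
    (hq : MvPolynomial.map (Int.castRingHom ℚ) (tracePolynomial w) =
      Polynomial.aeval q (Polynomial.dickson 1 (1 : ℚ) r))
    {k : Type} [CommRing k] [Algebra ℚ k] (g₁ g₂ : SL(2, k)) :
    ∃ Q : k, ((wordValue w g₁ g₂ : SL(2, k)) : Matrix (Fin 2) (Fin 2) k).trace =
      (dickson 1 (1 : k) r).eval Q := by
  have h := tracePolynomial_spec w k g₁ g₂
  set p := ![(g₁ : Matrix (Fin 2) (Fin 2) k).trace,
        ((g₁ * g₂ : SL(2, k)) : Matrix (Fin 2) (Fin 2) k).trace,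
        (g₂ : Matrix (Fin 2) (Fin 2) k).trace]
  refine ⟨MvPolynomial.aeval p q, ?_⟩
  have h2 := congrArg (MvPolynomial.aeval (R := ℚ) p) hq
  rw [← Polynomial.aeval_algHom_apply, MvPolynomial.aeval_def, MvPolynomial.eval₂_map] at h2
  rw [h, MvPolynomial.aeval_def, ← map_one (algebraMap ℚ k), ← map_dickson, eval_map_algebraMap,
    ← h2]
  congr 1
  exact RingHom.ext_int _ _

/-- The coefficient of top degree of the trace of a word is an `r`-th power, if the trace
polynomial is `D_r(q)`. -/
theorem exists_pow_eq_trace_prod {R : Type} [CommRing R] [IsDomain R] [Algebra ℚ R] {r N : ℕ}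
    (hr : 0 < r) (hN : 0 < N) {a b : Fin r → ℤ} {q : MvPolynomial (Fin 3) ℚ}
    (hq : MvPolynomial.map (Int.castRingHom ℚ) (tracePolynomial (syllableWord a b)) =
      Polynomial.aeval q (Polynomial.dickson 1 (1 : ℚ) r))
    (g₁ g₂ : SL(2, R[X])) (E : Fin r → Matrix (Fin 2) (Fin 2) R)
    (hE : ∀ i, HasTopCoeff (((g₁ ^ a i : SL(2, R[X])) : Matrix (Fin 2) (Fin 2) R[X]) *
        ((g₂ ^ b i : SL(2, R[X])) : Matrix (Fin 2) (Fin 2) R[X])) N (E i))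
    (h0 : (List.ofFn E).prod.trace ≠ 0) :
    ∃ c, (List.ofFn E).prod.trace = c ^ r := by
  obtain ⟨Q, hQ⟩ := exists_trace_wordValue_eq_dickson hq g₁ g₂
  have ht := (HasTopCoeff.list_prod_ofFn hE).trace
  rw [← coe_wordValue_syllableWord, hQ] at ht
  rw [← ht.2] at h0 ⊢
  exact exists_pow_eq_coeff_dickson hr hN Q ht.1 h0

end Matrices

/-! ### Equality of absolute values, by roots of Chebyshev polynomials -/

section Sizes

open Polynomial Real

theorem trace_list_prod_ofFn_upper {R : Type*} [CommRing R] {r : ℕ}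
    (E : Fin r → Matrix (Fin 2) (Fin 2) R) (h : ∀ i, E i 1 0 = 0) :
    (List.ofFn E).prod.trace = ∏ i, E i 0 0 + ∏ i, E i 1 1 := by
  have key : (List.ofFn E).prod 1 0 = 0 ∧ (List.ofFn E).prod 0 0 = ∏ i, E i 0 0 ∧
      (List.ofFn E).prod 1 1 = ∏ i, E i 1 1 := by
    induction r with
    | zero => simp
    | succ r ih =>
      obtain ⟨h1, h2, h3⟩ := ih (fun i => E i.succ) fun i => h i.succ
      rw [List.ofFn_succ, List.prod_cons, Fin.prod_univ_succ, Fin.prod_univ_succ]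
      simp [Matrix.mul_apply, Fin.sum_univ_two, h1, h2, h3, h 0]
  rw [Matrix.trace_fin_two, key.2.1, key.2.2]

theorem chebyshev_S_eval_C_two_mul_X (n : ℤ) :
    (Chebyshev.S ℝ[X][X] n).eval (C (2 * X)) = C (Chebyshev.U ℝ n) := by
  rw [← Chebyshev.S_comp_two_mul_X, ← Chebyshev.aeval_S (R := ℝ), Polynomial.aeval_def, comp,
    Polynomial.hom_eval₂]
  rfl

theorem hasTopCoeff_unipotentSL_zpow {R : Type*} [CommRing R] (n : ℤ) :
    HasTopCoeff ((unipotentSL (X : R[X]) ^ n : SL(2, R[X])) : Matrix (Fin 2) (Fin 2) R[X]) 1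
      !![0, (n : R); 0, 0] := by
  apply hasTopCoeff_of_entries
  rw [coe_unipotentSL_zpow]
  intro i j
  have hX : (C (n : R) * X).natDegree ≤ 1 := by simpa using natDegree_C_mul_X_pow_le (n : R) 1
  have h : (n : R[X]) * X = C (n : R) * X := by simp
  fin_cases i <;> fin_cases j <;> simp [h, hX, coeff_one, -map_intCast]

theorem hasTopCoeff_companionSL_zpow_const (n : ℤ) :
    HasTopCoeff ((companionSL (C (2 * X : ℝ[X])) ^ n : SL(2, ℝ[X][X])) :
        Matrix (Fin 2) (Fin 2) ℝ[X][X]) 0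
      !![Chebyshev.U ℝ n, -Chebyshev.U ℝ (n - 1);
        Chebyshev.U ℝ (n - 1), -Chebyshev.U ℝ (n - 2)] := by
  convert hasTopCoeff_map_C _ using 1
  rw [coe_companionSL_zpow]
  simp only [chebyshev_S_eval_C_two_mul_X]
  ext1 i j
  fin_cases i <;> fin_cases j <;> simp

section

variable {r : ℕ} (hr : 0 < r) {a b : Fin r → ℤ} (ha : ∀ i, a i ≠ 0) (hb : ∀ i, b i ≠ 0)
  {q : MvPolynomial (Fin 3) ℚ}
  (hq : MvPolynomial.map (Int.castRingHom ℚ) (tracePolynomial (syllableWord a b)) =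
    Polynomial.aeval q (Polynomial.dickson 1 (1 : ℚ) r))
include hr ha hb hq

/-- The leading matrix of each syllable has zero first column, so the trace of the product is the
product of the lower right entries. -/
theorem exists_pow_eq_prod_chebyshev_left :
    ∃ A : ℝ[X], ∏ i, (C (b i : ℝ) * Chebyshev.U ℝ (a i - 1)) = A ^ r := by
  let E (i : Fin r) : Matrix (Fin 2) (Fin 2) ℝ[X] :=
    !![Chebyshev.U ℝ (a i), -Chebyshev.U ℝ (a i - 1);
      Chebyshev.U ℝ (a i - 1), -Chebyshev.U ℝ (a i - 2)] * !![0, (b i : ℝ[X]); 0, 0]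
  have hE : (List.ofFn E).prod.trace = ∏ i, (C (b i : ℝ) * Chebyshev.U ℝ (a i - 1)) := by
    rw [trace_list_prod_ofFn_upper _ fun i => by simp [E]]
    simp [E, hr.ne', mul_comm]
  rw [← hE]
  refine exists_pow_eq_trace_prod hr one_pos hq (companionSL (C (2 * X))) (unipotentSL X) E
    (fun i => ?_) ?_
  · exact (hasTopCoeff_companionSL_zpow_const (a i)).mul (hasTopCoeff_unipotentSL_zpow (b i))
  · rw [hE, Finset.prod_ne_zero_iff]
    intro i _
    refine mul_ne_zero (by simpa using hb i) (Chebyshev.U_ne_zero _ _ ?_)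
    have := ha i
    omega

/-- With the matrices exchanged, the second row of each leading matrix vanishes and the upper left
entries survive. -/
theorem exists_pow_eq_prod_chebyshev_right :
    ∃ A : ℝ[X], ∏ i, (C (a i : ℝ) * Chebyshev.U ℝ (b i - 1)) = A ^ r := by
  let E (i : Fin r) : Matrix (Fin 2) (Fin 2) ℝ[X] :=
    !![0, (a i : ℝ[X]); 0, 0] * !![Chebyshev.U ℝ (b i), -Chebyshev.U ℝ (b i - 1);
      Chebyshev.U ℝ (b i - 1), -Chebyshev.U ℝ (b i - 2)]
  have hE : (List.ofFn E).prod.trace = ∏ i, (C (a i : ℝ) * Chebyshev.U ℝ (b i - 1)) := by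
    rw [trace_list_prod_ofFn_upper _ fun i => by simp [E]]
    simp [E, hr.ne']
  rw [← hE]
  refine exists_pow_eq_trace_prod hr one_pos hq (unipotentSL X) (companionSL (C (2 * X))) E
    (fun i => ?_) ?_
  · exact (hasTopCoeff_unipotentSL_zpow (a i)).mul (hasTopCoeff_companionSL_zpow_const (b i))
  · rw [hE, Finset.prod_ne_zero_iff]
    intro i _
    refine mul_ne_zero (by simpa using ha i) (Chebyshev.U_ne_zero _ _ ?_)
    have := hb i
    omega

end

/-- The roots of `U_{m-1}` are the simple roots `cos(kπ/m)` with `0 < k < m`. By injectivity of the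
cosine on `[0, π]`, one of them equals `cos(π/n)` only if `k n = m`, which forces `m = n` when `m ≤
n`. -/
theorem count_roots_chebyshev {n m : ℕ} (hn : 2 ≤ n) (hm : 0 < m) (hmn : m ≤ n) :
    (Chebyshev.U ℝ ((m : ℤ) - 1)).roots.count (cos (π / n)) = if m = n then 1 else 0 := by
  obtain ⟨m, rfl⟩ : ∃ k, m = k + 1 := ⟨m - 1, by omega⟩
  rw [show ((m + 1 : ℕ) : ℤ) - 1 = m by push_cast; ring]
  split_ifs with h
  · have := Chebyshev.rootMultiplicity_U_real (n := m) (k := 0) (by omega)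
    have he : π / n = (((0 : ℕ) : ℝ) + 1) * π / (m + 1) := by
      rw [← h]
      push_cast
      ring
    rw [count_roots, he]
    exact this
  · rw [Chebyshev.roots_U_real, Multiset.count_eq_zero]
    simp only [Finset.mem_val, Finset.mem_image, Finset.mem_range, not_exists, not_and]
    intro k hk hcos
    have hn0 : (0 : ℝ) < n := by exact_mod_cast (by omega : 0 < n)
    have hm0 : (0 : ℝ) < m + 1 := by positivity
    have hk' : (k : ℝ) + 1 ≤ m + 1 := by exact_mod_cast (by omega : k + 1 ≤ m + 1)
    have h1 : (1 : ℝ) ≤ n := by exact_mod_cast (by omega : 1 ≤ n)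
    have := injOn_cos (x₁ := ((k : ℝ) + 1) * π / (m + 1)) (x₂ := π / n)
      ⟨by positivity, by rw [div_le_iff₀ hm0]; nlinarith [pi_pos]⟩
      ⟨by positivity, div_le_self pi_pos.le h1⟩ hcos
    rw [div_eq_div_iff hm0.ne' hn0.ne', mul_right_comm, mul_comm π, mul_left_inj' pi_ne_zero]
      at this
    have h2 : (k + 1) * n = m + 1 := by exact_mod_cast this
    have : n ≤ (k + 1) * n := Nat.le_mul_of_pos_left _ (by omega)
    omega

/-- If a product of `r` Chebyshev polynomials `U_{d_i - 1}` is proportional to an `r`-th power, then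
all `|d_i|` are equal. -/
theorem natAbs_eq_of_prod_chebyshev_eq_pow {r : ℕ} {c d : Fin r → ℤ} (hc : ∀ i, c i ≠ 0)
    (hd : ∀ i, d i ≠ 0) {A : ℝ[X]}
    (h : ∏ i, (C (c i : ℝ) * Chebyshev.U ℝ (d i - 1)) = A ^ r) (i j : Fin r) :
    (d i).natAbs = (d j).natAbs := by
  have hroots (i : Fin r) : (C (c i : ℝ) * Chebyshev.U ℝ (d i - 1)).roots =
      (Chebyshev.U ℝ (((d i).natAbs : ℤ) - 1)).roots := by
    rw [roots_C_mul _ (by simpa using hc i)]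
    rcases Int.natAbs_eq (d i) with h | h
    · rw [← h]
    · nth_rw 1 [h]
      rw [Chebyshev.U_neg_sub_one, roots_neg]
  have hne (i : Fin r) : C (c i : ℝ) * Chebyshev.U ℝ (d i - 1) ≠ 0 := by
    refine mul_ne_zero (by simpa using hc i) (Chebyshev.U_ne_zero _ _ ?_)
    have := hd i
    omega
  obtain ⟨l, -, hl⟩ := Finset.exists_max_image Finset.univ (fun i => (d i).natAbs)
    ⟨i, Finset.mem_univ i⟩
  set n := (d l).natAbs with hn
  suffices ∀ i, (d i).natAbs = n by rw [this i, this j]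
  have hpos (i : Fin r) : 0 < (d i).natAbs := Int.natAbs_pos.2 (hd i)
  -- If the maximum is `1`, there are no roots to count, but every `|d_i|` is already `1`.
  rcases Nat.lt_or_ge n 2 with hn2 | hn2
  · intro i
    have := hl i (Finset.mem_univ i)
    have := hpos i
    omega
  -- Multiplicity of `cos(π/n)` on both sides: the number of `i` attaining the maximum is a multiple
  -- of `r`.
  have hcount := congrArg (fun p => p.roots.count (cos (π / n))) h
  simp only [roots_pow, Multiset.count_nsmul] at hcount
  rw [roots_prod _ _ (Finset.prod_ne_zero_iff.2 fun i _ => hne i), Multiset.count_bind] at hcount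
  simp only [hroots, count_roots_chebyshev hn2 (hpos _) (hl _ (Finset.mem_univ _))] at hcount
  change ∑ i, (if (d i).natAbs = n then 1 else 0) = _ at hcount
  rw [Finset.sum_boole, Nat.cast_id] at hcount
  have hcard : (Finset.univ.filter fun i => (d i).natAbs = n).card ≤ r :=
    (Finset.card_le_univ _).trans_eq (Fintype.card_fin r)
  have hcard' : 0 < (Finset.univ.filter fun i => (d i).natAbs = n).card :=
    Finset.card_pos.2 ⟨l, by simp [hn]⟩
  have hfull : (Finset.univ.filter fun i => (d i).natAbs = n).card = r :=
    le_antisymm hcard (Nat.le_of_dvd hcard' ⟨_, hcount⟩)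
  intro i
  have := (Finset.card_eq_iff_eq_univ _).1 (hfull.trans (Fintype.card_fin r).symm)
  have hi := Finset.mem_univ i
  rw [← this] at hi
  exact (Finset.mem_filter.1 hi).2

end Sizes

/-! ### Constancy of signs, by powers of two -/

section Signs

open Polynomial

/-- The diagonal idempotent of size two selected by a sign. -/
def signIdempotent (R : Type*) [CommRing R] (e : Bool) : Matrix (Fin 2) (Fin 2) R :=
  if e then !![1, 0; 0, 0] else !![0, 0; 0, 1]

/-- For `n > 0` the entry `S_n` dominates. For `n = -k < 0` the identity `S_{-k-2} = -S_k` moves the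
dominant entry to the lower right corner. -/
theorem hasTopCoeff_companionSL_X_zpow {R : Type*} [CommRing R] [Nontrivial R] (n : ℤ)
    (hn : n ≠ 0) :
    HasTopCoeff ((companionSL (X : R[X]) ^ n : SL(2, R[X])) : Matrix (Fin 2) (Fin 2) R[X])
      n.natAbs (signIdempotent R (0 < n)) := by
  have hS (m : ℤ) : (Chebyshev.S R[X] m).eval X = Chebyshev.S R m := by
    rw [← Chebyshev.aeval_S (R := R), aeval_X_left_apply]
  have htop (n : ℕ) : (Chebyshev.S R n).natDegree ≤ n ∧ (Chebyshev.S R n).coeff n = 1 := by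
    obtain ⟨h1, h2⟩ := monic_natDegree_chebyshev_S (R := R) n
    refine ⟨h2.le, ?_⟩
    nth_rw 2 [← h2]
    exact h1
  have hlow (m : ℤ) (n : ℕ) (h1 : -1 ≤ m) (h2 : m < n) :
      (Chebyshev.S R m).natDegree ≤ n ∧ (Chebyshev.S R m).coeff n = 0 := by
    rcases h1.eq_or_lt with rfl | h
    · simp
    · lift m to ℕ using by omega
      have := (monic_natDegree_chebyshev_S (R := R) m).2
      exact ⟨by omega, coeff_eq_zero_of_natDegree_lt (by omega)⟩
  apply hasTopCoeff_of_entries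
  rw [coe_companionSL_zpow]
  simp only [hS]
  rcases lt_or_gt_of_ne hn with h | h
  · obtain ⟨k, hk⟩ := Int.eq_ofNat_of_zero_le (neg_nonneg.2 h.le)
    obtain rfl : n = -(k : ℤ) := by omega
    have h0 : ¬(k : ℤ) < 0 := by omega
    have h1 := hlow (k - 1) k (by omega) (by omega)
    have h2 := hlow (k - 2) k (by omega) (by omega)
    have h3 := htop k
    intro i j
    rw [Chebyshev.S_neg_sub_one, Chebyshev.S_neg_sub_two, Chebyshev.S_neg]
    fin_cases i <;> fin_cases j <;> simp [signIdempotent, h0, h1, h2, h3]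
  · lift n to ℕ using h.le
    have h1 := hlow (n - 1) n (by omega) (by omega)
    have h2 := hlow (n - 2) n (by omega) (by omega)
    have h3 := htop n
    have h0 : 0 < n := by omega
    intro i j
    fin_cases i <;> fin_cases j <;> simp [signIdempotent, h0, h1, h2, h3]

/-- A matrix in general position with respect to the coordinate axes. -/
def obliqueSL (R : Type*) [CommRing R] : SL(2, R) :=
  ⟨!![2, 1; 1, 1], by rw [Matrix.det_fin_two_of]; norm_num⟩

theorem hasTopCoeff_conj_companionSL_X_zpow {R : Type*} [CommRing R] [Nontrivial R] (n : ℤ)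
    (hn : n ≠ 0) :
    HasTopCoeff (((obliqueSL R[X] * companionSL (X : R[X]) * (obliqueSL R[X])⁻¹) ^ n :
        SL(2, R[X])) : Matrix (Fin 2) (Fin 2) R[X])
      n.natAbs (!![2, 1; 1, 1] * signIdempotent R (0 < n) * !![1, -1; -1, 2]) := by
  rw [conj_zpow, Matrix.SpecialLinearGroup.coe_mul, Matrix.SpecialLinearGroup.coe_mul]
  have h1 := hasTopCoeff_map_C (!![2, 1; 1, 1] : Matrix (Fin 2) (Fin 2) R)
  have h2 := hasTopCoeff_map_C (!![1, -1; -1, 2] : Matrix (Fin 2) (Fin 2) R)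
  have hC : (C 2 : R[X]) = 2 := rfl
  have e1 : (!![2, 1; 1, 1] : Matrix (Fin 2) (Fin 2) R).map C = (obliqueSL R[X] : SL(2, R[X])) := by
    ext1 i j
    fin_cases i <;> fin_cases j <;> simp [obliqueSL, hC]
  have e2 : (!![1, -1; -1, 2] : Matrix (Fin 2) (Fin 2) R).map C =
      ((obliqueSL R[X])⁻¹ : SL(2, R[X])) := by
    rw [Matrix.SpecialLinearGroup.coe_inv, Matrix.adjugate_fin_two]
    ext1 i j
    fin_cases i <;> fin_cases j <;> simp [obliqueSL, hC]
  rw [e1] at h1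
  rw [e2] at h2
  simpa using (h1.mul (hasTopCoeff_companionSL_X_zpow n hn)).mul h2

theorem list_prod_ofFn_vecMulVec {R ι : Type*} [CommRing R] [Fintype ι] [DecidableEq ι] {n : ℕ}
    (u v : Fin (n + 1) → ι → R) :
    (List.ofFn fun i => Matrix.vecMulVec (u i) (v i)).prod =
      (∏ i : Fin n, v i.castSucc ⬝ᵥ u i.succ) • Matrix.vecMulVec (u 0) (v (Fin.last n)) := by
  induction n with
  | zero => simp
  | succ n ih =>
    rw [List.ofFn_succ, List.prod_cons, ih (fun i => u i.succ) (fun i => v i.succ),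
      Fin.prod_univ_succ, Matrix.mul_smul, Matrix.vecMulVec_mul_vecMulVec]
    ext i j
    simp [Matrix.vecMulVec_apply]
    ring

/-- Neighbouring rank-one factors contract to scalars, and the trace closes the cycle: `i + 1` wraps
around in `Fin (n + 1)`. -/
theorem trace_list_prod_ofFn_vecMulVec {R ι : Type*} [CommRing R] [Fintype ι] [DecidableEq ι]
    {n : ℕ} (u v : Fin (n + 1) → ι → R) :
    (List.ofFn fun i => Matrix.vecMulVec (u i) (v i)).prod.trace = ∏ i, v i ⬝ᵥ u (i + 1) := by
  rw [list_prod_ofFn_vecMulVec, Matrix.trace_smul, Matrix.trace_vecMulVec, Fin.prod_univ_castSucc,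
    Fin.last_add_one, dotProduct_comm]
  simp [Fin.coeSucc_eq_succ]

theorem Fin.forall_of_cyclic {n : ℕ} {p : Fin (n + 1) → Prop} (h : ∀ i, p (i + 1) → p i)
    {i : Fin (n + 1)} (hi : p i) (j : Fin (n + 1)) : p j := by
  have h0 : p 0 := by
    induction i using Fin.induction with
    | zero => exact hi
    | succ i ih => exact ih (h _ (by rwa [Fin.coeSucc_eq_succ]))
  induction j using Fin.reverseInduction with
  | last => exact h _ (by rwa [Fin.last_add_one])
  | cast j ih => exact h _ (by rwa [Fin.coeSucc_eq_succ])

/-- The absolute value of the trace of the product is `2` to the power of the number of `i` for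
which this indicator is `1`. -/
def signAgreement {n : ℕ} (e d : Fin (n + 1) → Bool) (i : Fin (n + 1)) : ℕ :=
  if e (i + 1) then (if d (i + 1) then 1 else 0) else (if d i then 0 else 1)

/-- The trace is a cyclic product of entries of `P` and `P⁻¹` selected by neighbouring signs. These
are `±1`, except for a `2` in `P` at signs `(+, +)` of `a_i, b_i` and a `2` in `P⁻¹` at signs `(-,
-)` of `b_i, a_{i+1}`. Grouped by the exponent of `x`, at most one factor `2` occurs per index. -/
theorem abs_trace_signIdempotent_prod {n : ℕ} (e d : Fin (n + 1) → Bool) :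
    |(List.ofFn fun i => signIdempotent ℚ (e i) *
      (!![2, 1; 1, 1] * signIdempotent ℚ (d i) * !![1, -1; -1, 2])).prod.trace| =
      2 ^ ∑ i, signAgreement e d i := by
  let u (i : Fin (n + 1)) : Fin 2 → ℚ :=
    if e i then (if d i then ![2, 0] else ![1, 0]) else ![0, 1]
  let v (i : Fin (n + 1)) : Fin 2 → ℚ := if d i then ![1, -1] else ![-1, 2]
  have h (i : Fin (n + 1)) : signIdempotent ℚ (e i) *
      (!![2, 1; 1, 1] * signIdempotent ℚ (d i) * !![1, -1; -1, 2]) =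
      Matrix.vecMulVec (u i) (v i) := by
    ext j l
    rcases he : e i <;> rcases hd : d i <;> fin_cases j <;> fin_cases l <;>
      simp [signIdempotent, u, v, Matrix.vecMulVec_apply, he, hd]
  simp only [h]
  rw [trace_list_prod_ofFn_vecMulVec, Finset.abs_prod, ← Finset.prod_pow_eq_pow_sum]
  refine Finset.prod_congr rfl fun i _ => ?_
  dsimp only [u, v, signAgreement]
  rcases e (i + 1) <;> rcases d (i + 1) <;> rcases d i <;> simp

/-- Compare 2-adic valuations. -/
theorem dvd_of_abs_eq_two_pow {x c : ℚ} {r K : ℕ} (hx : |x| = 2 ^ K) (hc : x = c ^ r) : r ∣ K := by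
  have h : |c| ^ r = ((2 : ℕ) : ℚ) ^ K := by rw [← abs_pow, ← hc, hx]; norm_num
  have hv := congrArg (padicValRat 2) h
  rw [padicValRat.pow, padicValRat.pow, padicValRat.self one_lt_two, mul_one] at hv
  exact Int.natCast_dvd_natCast.1 ⟨_, hv.symm⟩

/-- If the number of agreements is divisible by the length, all signs are constant. -/
theorem signs_const_of_dvd {n : ℕ} {e d : Fin (n + 1) → Bool}
    (h : (n + 1) ∣ ∑ i, signAgreement e d i) (i j : Fin (n + 1)) : e i = e j ∧ d i = d j := by
  have hle (i : Fin (n + 1)) : signAgreement e d i ≤ 1 := by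
    unfold signAgreement
    split_ifs <;> simp
  have hall : (∀ i, signAgreement e d i = 0) ∨ (∀ i, signAgreement e d i = 1) := by
    have hsum : ∑ i, signAgreement e d i ≤ ∑ _i : Fin (n + 1), 1 :=
      Finset.sum_le_sum fun i _ => hle i
    rcases Nat.eq_zero_or_pos (∑ i, signAgreement e d i) with h0 | h0
    · left
      simpa using h0
    · right
      have hge := Nat.le_of_dvd h0 h
      have heq : ∑ i, signAgreement e d i = ∑ _i : Fin (n + 1), 1 := by
        refine hsum.antisymm ?_
        simpa using hge
      simpa using (Finset.sum_eq_sum_iff_of_le fun i _ => hle i).1 heq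
  have hcases : (∀ i, (e (i + 1) = true → d (i + 1) = false) ∧ (e (i + 1) = false → d i = true)) ∨
      (∀ i, (e (i + 1) = true → d (i + 1) = true) ∧ (e (i + 1) = false → d i = false)) := by
    refine hall.imp (fun hall i => ?_) (fun hall i => ?_) <;>
    · have hi := hall i
      unfold signAgreement at hi
      constructor <;> intro hei <;> simpa [hei] using hi
  -- If `e i` were true and `e (i + 1)` false, the two neighbours of `d i` would force opposite
  -- values on it. Hence false values of `e` spread backwards around the cycle.
  have hback (i : Fin (n + 1)) (hi : e (i + 1) = false) : e i = false := by
    obtain ⟨i, rfl⟩ : ∃ k, i = k + 1 := ⟨i - 1, (sub_add_cancel i 1).symm⟩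
    by_contra hne
    rw [Bool.not_eq_false] at hne
    rcases hcases with hc | hc
    · have h1 := (hc _).1 hne
      have h2 := (hc _).2 hi
      simp [h1] at h2
    · have h1 := (hc _).1 hne
      have h2 := (hc _).2 hi
      simp [h1] at h2
  by_cases hex : ∃ i, e i = false
  · obtain ⟨l, hl⟩ := hex
    have he := Fin.forall_of_cyclic (p := fun i => e i = false) hback hl
    refine ⟨by rw [he, he], ?_⟩
    rcases hcases with hc | hc <;> rw [(hc i).2 (he _), (hc j).2 (he _)]
  · simp only [not_exists, Bool.not_eq_false] at hex
    refine ⟨by rw [hex, hex], ?_⟩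
    rw [← sub_add_cancel i 1, ← sub_add_cancel j 1]
    rcases hcases with hc | hc <;> rw [(hc _).1 (hex _), (hc _).1 (hex _)]

end Signs

theorem corollary2p14 (r : ℕ) (hr : 0 < r) (a b : Fin r → ℤ)
    (ha : ∀ i, a i ≠ 0) (hb : ∀ i, b i ≠ 0)
    (q : MvPolynomial (Fin 3) ℚ)
    (hq : MvPolynomial.map (Int.castRingHom ℚ) (tracePolynomial (syllableWord a b)) =
      Polynomial.aeval q (Polynomial.dickson 1 (1 : ℚ) r)) :
    syllableWord a b =
      ((FreeGroup.of 0 : FreeGroup (Fin 2)) ^ a ⟨0, hr⟩ * FreeGroup.of 1 ^ b ⟨0, hr⟩) ^ r := by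
  obtain ⟨A, hA⟩ := exists_pow_eq_prod_chebyshev_left hr ha hb hq
  obtain ⟨B, hB⟩ := exists_pow_eq_prod_chebyshev_right hr ha hb hq
  have hna := natAbs_eq_of_prod_chebyshev_eq_pow hb ha hA
  have hnb := natAbs_eq_of_prod_chebyshev_eq_pow ha hb hB
  obtain ⟨n, rfl⟩ : ∃ n, r = n + 1 := ⟨r - 1, by omega⟩
  let e (i : Fin (n + 1)) : Bool := 0 < a i
  let d (i : Fin (n + 1)) : Bool := 0 < b i
  have htrace := abs_trace_signIdempotent_prod e d
  -- Since the absolute values are already constant, every syllable has the same degree bound `N`.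
  obtain ⟨c, hc⟩ := exists_pow_eq_trace_prod (R := ℚ) (N := (a 0).natAbs + (b 0).natAbs) hr
    (by have := Int.natAbs_pos.2 (ha 0); omega) hq (companionSL Polynomial.X)
    (obliqueSL _ * companionSL Polynomial.X * (obliqueSL _)⁻¹)
    (fun i => signIdempotent ℚ (e i) *
      (!![2, 1; 1, 1] * signIdempotent ℚ (d i) * !![1, -1; -1, 2]))
    (fun i => by
      rw [hna 0 i, hnb 0 i]
      exact (hasTopCoeff_companionSL_X_zpow _ (ha i)).mul
        (hasTopCoeff_conj_companionSL_X_zpow _ (hb i)))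
    (by rw [← abs_pos, htrace]; positivity)
  have hsign := signs_const_of_dvd (dvd_of_abs_eq_two_pow htrace hc)
  have haconst (i : Fin (n + 1)) : a i = a 0 := by
    have h1 := hna i 0
    have h2 : (0 < a i) ↔ (0 < a 0) := by simpa [e] using (hsign i 0).1
    omega
  have hbconst (i : Fin (n + 1)) : b i = b 0 := by
    have h1 := hnb i 0
    have h2 : (0 < b i) ↔ (0 < b 0) := by simpa [d] using (hsign i 0).2
    omega
  unfold syllableWord
  simp only [haconst, hbconst, List.ofFn_const, List.prod_replicate]
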